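/- A t-norm is a map $T:[0,1]^2\to[0,1]$ that is commutative, associative, nondecreasing in each argument and satisfies $T(x,1)=x$; a t-conorm is a map $S:[0,1]^2\to[0,1]$ that is commutative, associative, nondecreasing in each argument and satisfies $S(x,0)=x$; a negation is a nonincreasing map $N:[0,1]\to[0,1]$ with $N(0)=1$ and $N(1)=0$. Let $M$ be a natural number. Let $\mathbf S_1$ be the set of formulas built from the variables $A_1,\dots,A_M$ with the connectives $\vee,\wedge,{}'$ (or, and, not), let $\mathbf V_2$ be the set of elementary sentences "$\mathrm{Tr}(B)=b$" with $B\in\mathbf S_1$ and $b\in[0,1]$, and let $\mathbf S_2$ be the set of formulas built from the elements of $\mathbf V_2$ with the connectives $\vee,\wedge,{}'$. Suppose $\vee,\wedge,{}'$ are implemented numerically, at both levels, by a continuous t-conorm $S$, a continuous t-norm $T$ and a continuous negation $N$ respectively. For $x=(x_1,\dots,x_M)\in[0,1]^M$ define truth values by $\mathrm{Tr}(A_m)=x_m$; by $\mathrm{Tr}(P\vee Q)=S(\mathrm{Tr}(P),\mathrm{Tr}(Q))$, $\mathrm{Tr}(P\wedge Q)=T(\mathrm{Tr}(P),\mathrm{Tr}(Q))$,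 $\mathrm{Tr}(P')=N(\mathrm{Tr}(P))$ on $\mathbf S_1$ and on $\mathbf S_2$; and by $\mathrm{Tr}(\text{"}\mathrm{Tr}(B)=b\text{"})=1-|\mathrm{Tr}(B)-b|$ on $\mathbf V_2$. For $D\in\mathbf S_2$ let $f_D:[0,1]^M\to[0,1]$ be the function that sends $x$ to the resulting value $\mathrm{Tr}(D)$. Then, for every choice of $D_1,\dots,D_M\in\mathbf S_2$ (where $A_m$ is taken to say $D_m$), the system of truth value equations $$x_m=f_{D_m}(x_1,\dots,x_M),\qquad m=1,\dots,M,$$ has at least one solution $\overline x\in[0,1]^M$, i.e. there is a consistent fuzzy truth value assignment. -/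

import Mathlib

namespace FuzzyTruth

/-- Truth values: the real unit interval `[0,1]`. -/
abbrev TruthValue : Type := unitInterval

/-- Logical formulas built from elementary sentences in `V` with "or", "and", "not". -/
inductive Formula (V : Type) : Type where
  | elem (v : V) : Formula V
  | disj (P Q : Formula V) : Formula V
  | conj (P Q : Formula V) : Formula V
  | neg (P : Formula V) : Formula V

/-- First-level sentences: formulas in the variables `A_1, ..., A_M`. -/
abbrev FirstLevel (M : ℕ) : Type := Formula (Fin M)

/-- Second-level elementary sentences "Tr(B) = b", where `B` is a first-level sentence
and `b ∈ [0,1]`. -/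
structure ElemAssessment (M : ℕ) : Type where
  /-- the first-level sentence `B` spoken about -/
  sentence : FirstLevel M
  /-- the truth value `b` that is claimed for `B` -/
  value : TruthValue

/-- Second-level sentences (truth value assessments): formulas in the second-level
elementary sentences. -/
abbrev SecondLevel (M : ℕ) : Type := Formula (ElemAssessment M)

/-- Triangular norms on `[0,1]`. -/
structure IsTNorm (T : TruthValue → TruthValue → TruthValue) : Prop where
  comm : ∀ x y, T x y = T y x
  assoc : ∀ x y z, T (T x y) z = T x (T y z)
  mono : ∀ x y z, y ≤ z → T x y ≤ T x z
  unit : ∀ x, T x 1 = x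

/-- Triangular conorms on `[0,1]`. -/
structure IsTConorm (S : TruthValue → TruthValue → TruthValue) : Prop where
  comm : ∀ x y, S x y = S y x
  assoc : ∀ x y z, S (S x y) z = S x (S y z)
  mono : ∀ x y z, y ≤ z → S x y ≤ S x z
  unit : ∀ x, S x 0 = x

/-- Negations on `[0,1]` (not required to be strict or involutive). -/
structure IsNegation (N : TruthValue → TruthValue) : Prop where
  anti : ∀ x y, x ≤ y → N y ≤ N x
  zero : N 0 = 1
  one : N 1 = 0

/-- A numerical implementation of the three logical operators. -/
structure Implementation : Type where
  /-- numerical "or" -/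
  or' : TruthValue → TruthValue → TruthValue
  /-- numerical "and" -/
  and' : TruthValue → TruthValue → TruthValue
  /-- numerical "not" -/
  not' : TruthValue → TruthValue

/-- The operators are a continuous t-conorm, a continuous t-norm and a continuous negation
(continuity of the binary operators is joint continuity on `[0,1] × [0,1]`). -/
structure Implementation.IsContinuousFuzzy (I : Implementation) : Prop where
  tconorm : IsTConorm I.or'
  tnorm : IsTNorm I.and'
  negation : IsNegation I.not'
  continuous_or : Continuous fun p : TruthValue × TruthValue => I.or' p.1 p.2
  continuous_and : Continuous fun p : TruthValue × TruthValue => I.and' p.1 p.2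
  continuous_not : Continuous I.not'

/-- Extension of a truth value assignment from elementary sentences to formulas. -/
def Formula.eval {V : Type} (I : Implementation) (t : V → TruthValue) :
    Formula V → TruthValue
  | .elem v => t v
  | .disj P Q => I.or' (P.eval I t) (Q.eval I t)
  | .conj P Q => I.and' (P.eval I t) (Q.eval I t)
  | .neg P => I.not' (P.eval I t)

/-- The number `1 - |y - b|`, which lies in `[0,1]` when `y` and `b` do. -/
def agreement (y b : TruthValue) : TruthValue :=
  ⟨1 - |(y : ℝ) - (b : ℝ)|, by
    obtain ⟨y, hy0, hy1⟩ := y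
    obtain ⟨b, hb0, hb1⟩ := b
    have h : |y - b| ≤ 1 := abs_le.mpr ⟨by linarith, by linarith⟩
    exact ⟨by simpa using h, by simp⟩⟩

variable {M : ℕ}

/-- `Tr(B)` for a first-level sentence `B`, given `Tr(A_m) = x_m`. -/
def trFirst (I : Implementation) (x : Fin M → TruthValue) (B : FirstLevel M) : TruthValue :=
  B.eval I x

/-- `Tr("Tr(B) = b") = 1 - |Tr(B) - b|`, given `Tr(A_m) = x_m`. -/
def trElem (I : Implementation) (x : Fin M → TruthValue) (C : ElemAssessment M) : TruthValue :=
  agreement (trFirst I x C.sentence) C.value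

/-- `Tr(D) = f_D(x_1, ..., x_M)` for a second-level sentence `D`, given `Tr(A_m) = x_m`. -/
def trSecond (I : Implementation) (x : Fin M → TruthValue) (D : SecondLevel M) : TruthValue :=
  D.eval I (trElem I x)

/-- The map `f = (f_1, ..., f_M) : [0,1]^M → [0,1]^M` of the collection `D_1, ..., D_M`. -/
def truthMap (I : Implementation) (D : Fin M → SecondLevel M)
    (x : Fin M → TruthValue) : Fin M → TruthValue :=
  fun m => trSecond I x (D m)

end FuzzyTruth

/-! Brouwer's fixed point theorem is proved with cochains mod 2 on the cubes of a grid in `[0,1]^n`.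
Label the grid points with functions `ℓ c`, one for each coordinate `c`, such that `ℓ c` is `0` on
the face `x c = 0` and `1` on the opposite face. The cochain `dℓ₁ ∪ ⋯ ∪ dℓₙ` is the coboundary of
`ℓ₁ (dℓ₂ ∪ ⋯ ∪ dℓₙ)`, which vanishes on every face of the grid except `x 1 = k`, where it is
`dℓ₂ ∪ ⋯ ∪ dℓₙ`. By Stokes' theorem and induction the sum of `dℓ₁ ∪ ⋯ ∪ dℓₙ` over all cubes is `1`,
so there is a cube on which no label is constant. Given a continuous self-map `f` of the unit cube,
let `ℓ c` be `1` at `x` if `x c ≠ 0` and `f x c ≤ x c`, and `0` otherwise. Refining the grid yields,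
by compactness, a point with `x c ≤ f x c` and `f x c ≤ x c` for all `c`.

Truth values of formulas depend continuously on `x ∈ [0,1]^M`, whence a consistent assignment. -/

section Grid

open Finset

theorem sum_sum_erase_comm {ι A : Type*} [DecidableEq ι] [AddCommMonoid A] (S : Finset ι)
    (F : ι → ι → A) : ∑ c ∈ S, ∑ d ∈ S.erase c, F c d = ∑ c ∈ S, ∑ d ∈ S.erase c, F d c :=
  sum_comm' fun c d => by simp only [mem_erase]; tauto

theorem sum_sum_erase_eq_zero_of_symm {ι R : Type*} [DecidableEq ι] [Semiring R] [CharP R 2]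
    (S : Finset ι) {F : ι → ι → R} (hF : ∀ c d, F c d = F d c) :
    ∑ c ∈ S, ∑ d ∈ S.erase c, F c d = 0 := by
  rw [sum_sigma']
  refine sum_involution (fun p _ => ⟨p.2, p.1⟩) ?_ ?_ ?_ fun _ _ => rfl
  · rintro ⟨c, d⟩ -
    rw [hF d c, CharTwo.add_self_eq_zero]
  · rintro ⟨c, d⟩ h - heq
    exact (mem_erase.1 (mem_sigma.1 h).2).1 (congrArg Sigma.fst heq)
  · rintro ⟨c, d⟩ h
    simp only [mem_sigma, mem_erase] at h ⊢
    tauto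

/-- Cubical cochains on the grid `ι → ℕ` with coefficients in `A`. The value `ω x S` is taken on
the unit cube with lowest corner `x` and edges in the directions in `S`. Cubes carry no orientation,
so `coboundary` squares to zero only in characteristic two. -/
abbrev CubicalCochain (ι A : Type*) : Type _ := (ι → ℕ) → Finset ι → A

namespace CubicalCochain

variable {ι : Type*} [DecidableEq ι]

/-- The coboundary `dω` of a cubical cochain. -/
def coboundary {A : Type*} [AddCommGroup A] (ω : CubicalCochain ι A) : CubicalCochain ι A :=
  fun x S => ∑ c ∈ S, (ω (x + Pi.single c 1) (S.erase c) - ω x (S.erase c))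

variable {R : Type*} [CommRing R]

/-- The cup product `dℓ ∪ ω`, where `dℓ` is the coboundary of the function `ℓ` on grid points.
The factor `dℓ` is evaluated on the edges at the lowest corner and `ω` on the opposite faces. -/
def coboundaryCup (ℓ : (ι → ℕ) → R) (ω : CubicalCochain ι R) : CubicalCochain ι R := fun x S =>
  ∑ c ∈ S, (ℓ (x + Pi.single c 1) - ℓ x) * ω (x + Pi.single c 1) (S.erase c)

/-- The iterated cup product `dℓ c₁ ∪ ⋯ ∪ dℓ cₙ` over a list `[c₁, …, cₙ]`. The product over the
empty list is the unit, which is `1` on vertices and `0` on cubes of positive dimension. -/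
def coboundaryCupList {κ : Type*} (ℓ : κ → (ι → ℕ) → R) : List κ → CubicalCochain ι R
  | [] => fun _ S => if S = ∅ then 1 else 0
  | c :: L => coboundaryCup (ℓ c) (coboundaryCupList ℓ L)

theorem coboundary_mul (h : (ι → ℕ) → R) (ω : CubicalCochain ι R) (x : ι → ℕ) (S : Finset ι) :
    coboundary (fun y T => h y * ω y T) x S =
      coboundaryCup h ω x S + h x * coboundary ω x S := by
  simp only [coboundary, coboundaryCup, mul_sum, ← sum_add_distrib]
  exact sum_congr rfl fun c _ => by ring

theorem coboundary_coboundaryCup [CharP R 2] (ℓ : (ι → ℕ) → R) (ω : CubicalCochain ι R) :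
    coboundary (coboundaryCup ℓ ω) = coboundaryCup ℓ (coboundary ω) := by
  funext x S
  have hsymm : ∑ c ∈ S, ∑ d ∈ S.erase c,
      (ℓ (x + Pi.single c 1 + Pi.single d 1) - ℓ (x + Pi.single c 1) - ℓ (x + Pi.single d 1) + ℓ x)
        * ω (x + Pi.single c 1 + Pi.single d 1) ((S.erase c).erase d) = 0 :=
    sum_sum_erase_eq_zero_of_symm S fun c d => by
      rw [add_right_comm x (Pi.single c 1), erase_right_comm]; ring
  have hcomm : coboundaryCup ℓ (coboundary ω) x S = ∑ c ∈ S, ∑ d ∈ S.erase c,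
      (ℓ (x + Pi.single d 1) - ℓ x) * (ω (x + Pi.single c 1 + Pi.single d 1) ((S.erase c).erase d)
        - ω (x + Pi.single d 1) ((S.erase c).erase d)) := by
    simp only [coboundaryCup, coboundary, mul_sum]
    rw [sum_sum_erase_comm]
    simp only [add_right_comm x, erase_right_comm]
  rw [← sub_eq_zero, ← hsymm, hcomm]
  simp only [coboundary, coboundaryCup, ← sum_sub_distrib]
  exact sum_congr rfl fun c _ => sum_congr rfl fun d _ => by ring

theorem coboundary_coboundaryCupList [CharP R 2] {κ : Type*} (ℓ : κ → (ι → ℕ) → R) (L : List κ) :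
    coboundary (coboundaryCupList ℓ L) = 0 := by
  induction L with
  | nil =>
    funext x S
    simp only [coboundary, coboundaryCupList, sub_self, sum_const_zero, Pi.zero_apply]
  | cons c L ih =>
    rw [coboundaryCupList, coboundary_coboundaryCup, ih]
    funext x S
    simp only [coboundaryCup, Pi.zero_apply, mul_zero, sum_const_zero]

theorem coboundaryCupList_cons_eq_coboundary [CharP R 2] {κ : Type*} (ℓ : κ → (ι → ℕ) → R) (c : κ)
    (L : List κ) : coboundaryCupList ℓ (c :: L) =
      coboundary fun x S => ℓ c x * coboundaryCupList ℓ L x S := by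
  funext x S
  rw [coboundary_mul, coboundary_coboundaryCupList, Pi.zero_apply, Pi.zero_apply, mul_zero,
    add_zero, coboundaryCupList]

theorem coboundaryCupList_eq_zero_of_const_on_face {κ : Type*} {ℓ : κ → (ι → ℕ) → R} {L : List κ}
    {a : κ} (ha : a ∈ L) {c : ι} {x : ι → ℕ} (hℓ : ∀ y z, y c = x c → z c = x c → ℓ a y = ℓ a z)
    {S : Finset ι} (hc : c ∉ S) : coboundaryCupList ℓ L x S = 0 := by
  induction L generalizing x S with
  | nil => cases ha
  | cons b L ih =>
    refine sum_eq_zero fun d hd => ?_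
    have hx : (x + Pi.single d 1 : ι → ℕ) c = x c := by
      rw [Pi.add_apply, Pi.single_eq_of_ne (ne_of_mem_of_not_mem hd hc).symm, add_zero]
    rcases List.mem_cons.1 ha with rfl | ha
    · rw [hℓ _ _ hx rfl, sub_self, zero_mul]
    · rw [ih ha (by rwa [hx]) (fun h => hc (mem_of_mem_erase h)), mul_zero]

theorem exists_label_ne_of_coboundaryCupList_ne_zero {κ : Type*} {ℓ : κ → (ι → ℕ) → R} {L : List κ}
    {x : ι → ℕ} {S : Finset ι} (h : coboundaryCupList ℓ L x S ≠ 0) {a : κ} (ha : a ∈ L) :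
    ∃ y ∈ Set.Icc x (x + Set.indicator S 1), ∃ z ∈ Set.Icc x (x + Set.indicator S 1),
      ℓ a y ≠ ℓ a z := by
  induction L generalizing x S with
  | nil => cases ha
  | cons b L ih =>
    obtain ⟨d, hd, hne⟩ := exists_ne_zero_of_sum_ne_zero h
    have hcorner : x + Pi.single d 1 + Set.indicator (S.erase d : Set ι) 1 =
        x + Set.indicator S 1 := by
      funext e
      by_cases hed : e = d <;> simp [Set.indicator_apply, hed, hd]
    rcases List.mem_cons.1 ha with rfl | ha
    · refine ⟨x + Pi.single d 1, ⟨le_self_add, hcorner ▸ le_self_add⟩, x, ⟨le_rfl, le_self_add⟩, ?_⟩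
      exact sub_ne_zero.1 (left_ne_zero_of_mul hne)
    · have hsub : Set.Icc (x + Pi.single d 1)
          (x + Pi.single d 1 + Set.indicator (S.erase d : Set ι) 1) ⊆
          Set.Icc x (x + Set.indicator S 1) := Set.Icc_subset_Icc le_self_add hcorner.le
      obtain ⟨y, hy, z, hz, hyz⟩ := ih (right_ne_zero_of_mul hne) ha
      exact ⟨y, hsub hy, z, hsub hz, hyz⟩

end CubicalCochain

section GridFace

variable {ι : Type*} [Fintype ι] [DecidableEq ι]

/-- The lowest corners of the unit cubes with directions `S` that make up the face `x c = k c`,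
`c ∉ S`, of the grid `∏ c, [0, k c]`. -/
def gridFace (k : ι → ℕ) (S : Finset ι) : Finset (ι → ℕ) :=
  Fintype.piFinset fun c => if c ∈ S then range (k c) else {k c}

theorem mem_gridFace {k : ι → ℕ} {S : Finset ι} {x : ι → ℕ} :
    x ∈ gridFace k S ↔ ∀ c, if c ∈ S then x c < k c else x c = k c := by
  refine Fintype.mem_piFinset.trans (forall_congr' fun c => ?_)
  split_ifs <;> simp

theorem sum_gridFace_eq_sum_erase {A : Type*} [AddCommMonoid A] (k : ι → ℕ) {S : Finset ι} {c : ι}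
    (hc : c ∈ S) (F : (ι → ℕ) → A) : ∑ x ∈ gridFace k S, F x =
      ∑ x ∈ gridFace k (S.erase c), ∑ i ∈ range (k c), F (Function.update x c i) := by
  rw [← sum_product']
  refine sum_nbij' (fun x => (Function.update x c (k c), x c)) (fun p => Function.update p.1 c p.2)
    ?_ ?_ ?_ ?_ ?_
  · intro x hx
    rw [mem_gridFace] at hx
    have hxc := hx c
    rw [if_pos hc] at hxc
    refine mem_product.2 ⟨mem_gridFace.2 fun d => ?_, mem_range.2 hxc⟩
    by_cases hd : d = c
    · subst hd; simp
    · simpa [hd] using hx d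
  · rintro ⟨x, i⟩ h
    obtain ⟨hx, hi⟩ := mem_product.1 h
    refine mem_gridFace.2 fun d => ?_
    by_cases hd : d = c
    · subst hd; simpa [hc] using hi
    · simpa [hd] using mem_gridFace.1 hx d
  · intro x _
    simp
  · rintro ⟨x, i⟩ h
    have hxc := mem_gridFace.1 (mem_product.1 h).1 c
    rw [if_neg (notMem_erase c S)] at hxc
    simp [← hxc]
  · intro x _
    simp

theorem sum_gridFace_coboundary {A : Type*} [AddCommGroup A] (k : ι → ℕ) (S : Finset ι)
    (ω : CubicalCochain ι A) : ∑ x ∈ gridFace k S, ω.coboundary x S =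
      ∑ c ∈ S, ∑ x ∈ gridFace k (S.erase c),
        (ω x (S.erase c) - ω (Function.update x c 0) (S.erase c)) := by
  simp only [CubicalCochain.coboundary]
  rw [sum_comm]
  refine sum_congr rfl fun c hc => ?_
  rw [sum_gridFace_eq_sum_erase k hc]
  refine sum_congr rfl fun x hx => ?_
  have hxc : x c = k c := by simpa using mem_gridFace.1 hx c
  have hshift : ∀ i, Function.update x c i + Pi.single c 1 = Function.update x c (i + 1) := by
    intro i
    funext d
    by_cases hd : d = c
    · subst hd; simp
    · simp [hd]
  simp only [hshift]
  rw [sum_range_sub (fun i => ω (Function.update x c i) (S.erase c)), ← hxc,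
    Function.update_eq_self]

theorem sum_gridFace_coboundaryCupList {R : Type*} [CommRing R] [CharP R 2] {k : ι → ℕ}
    {ℓ : ι → (ι → ℕ) → R} (h₀ : ∀ c x, x c = 0 → ℓ c x = 0) (h₁ : ∀ c x, x c = k c → ℓ c x = 1)
    {L : List ι} (hL : L.Nodup) :
    ∑ x ∈ gridFace k L.toFinset, CubicalCochain.coboundaryCupList ℓ L x L.toFinset = 1 := by
  induction L with
  | nil =>
    have hvertex : gridFace k ∅ = {k} := by
      ext x; simp [mem_gridFace, funext_iff]
    simp [CubicalCochain.coboundaryCupList, hvertex]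
  | cons a L ih =>
    obtain ⟨haL, hL⟩ := List.nodup_cons.1 hL
    have ha : a ∉ L.toFinset := mt List.mem_toFinset.1 haL
    have hzero : ∀ c ∈ L.toFinset, ∀ x, x c = 0 ∨ x c = k c → ∀ S : Finset ι, c ∉ S →
        CubicalCochain.coboundaryCupList ℓ L x S = 0 := by
      intro c hc x hx S hcS
      refine CubicalCochain.coboundaryCupList_eq_zero_of_const_on_face (List.mem_toFinset.1 hc)
        (fun y z hy hz => ?_) hcS
      rcases hx with hx | hx
      · rw [h₀ c y (hy.trans hx), h₀ c z (hz.trans hx)]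
      · rw [h₁ c y (hy.trans hx), h₁ c z (hz.trans hx)]
    rw [CubicalCochain.coboundaryCupList_cons_eq_coboundary, sum_gridFace_coboundary,
      List.toFinset_cons, sum_insert ha, erase_insert ha, ← ih hL]
    refine (add_eq_left.2 ?_).trans (sum_congr rfl fun x hx => ?_)
    · refine sum_eq_zero fun c hc => sum_eq_zero fun x hx => ?_
      have hxc : x c = k c := by simpa using mem_gridFace.1 hx c
      rw [hzero c hc x (Or.inr hxc) _ (notMem_erase c _),
        hzero c hc _ (Or.inl (Function.update_self ..)) _ (notMem_erase c _), mul_zero, mul_zero,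
        sub_self]
    · have hxa : x a = k a := by simpa [haL] using mem_gridFace.1 hx a
      rw [h₁ a x hxa, h₀ a _ (Function.update_self ..), one_mul, zero_mul, sub_zero]

end GridFace

theorem exists_unitCube_meets_of_separates_faces {ι : Type*} [Finite ι] (k : ι → ℕ)
    (A : ι → Set (ι → ℕ)) (h₀ : ∀ c x, x c = 0 → x ∉ A c)
    (h₁ : ∀ c x, x c = k c → x ∈ A c) :
    ∃ b : ι → ℕ, ∀ c, (∃ x ∈ Set.Icc b (b + 1), x ∈ A c) ∧ ∃ x ∈ Set.Icc b (b + 1), x ∉ A c := by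
  classical
  cases nonempty_fintype ι
  set ℓ : ι → (ι → ℕ) → ZMod 2 := fun c => (A c).indicator 1
  have hsum := sum_gridFace_coboundaryCupList (k := k) (ℓ := ℓ)
    (fun c x hx => Set.indicator_of_notMem (h₀ c x hx) _)
    (fun c x hx => Set.indicator_of_mem (h₁ c x hx) _) (nodup_toList univ)
  obtain ⟨b, -, hb⟩ := exists_ne_zero_of_sum_ne_zero (hsum.trans_ne one_ne_zero)
  refine ⟨b, fun c => ?_⟩
  obtain ⟨y, hy, z, hz, hyz⟩ := CubicalCochain.exists_label_ne_of_coboundaryCupList_ne_zero hb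
    (mem_toList.2 (mem_univ c))
  simp only [toList_toFinset, coe_univ, Set.indicator_univ] at hy hz
  by_cases hyA : y ∈ A c <;> by_cases hzA : z ∈ A c
  · exact absurd (by simp [ℓ, hyA, hzA]) hyz
  · exact ⟨⟨y, hy, hyA⟩, z, hz, hzA⟩
  · exact ⟨⟨z, hz, hzA⟩, y, hy, hyA⟩
  · exact absurd (by simp [ℓ, hyA, hzA]) hyz

end Grid

section UnitCube

open Filter Topology

variable {ι : Type*}

/-- The point `x / k` of the unit cube; coordinates of `x` above `k` are sent to `1`. -/
noncomputable def gridPoint (k : ℕ) (x : ι → ℕ) : ι → unitInterval :=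
  fun c => Set.projIcc 0 1 zero_le_one ((x c : ℝ) / k)

theorem gridPoint_apply_eq_zero (k : ℕ) {x : ι → ℕ} {c : ι} (hx : x c = 0) :
    gridPoint k x c = 0 := by
  rw [gridPoint, hx, Nat.cast_zero, zero_div, Set.projIcc_left]; rfl

theorem gridPoint_apply_eq_one {k : ℕ} (hk : k ≠ 0) {x : ι → ℕ} {c : ι} (hx : x c = k) :
    gridPoint k x c = 1 := by
  rw [gridPoint, hx, div_self (Nat.cast_ne_zero.2 hk), Set.projIcc_right]; rfl

theorem dist_gridPoint_le [Fintype ι] (k : ℕ) {b x : ι → ℕ} (hx : x ∈ Set.Icc b (b + 1)) :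
    dist (gridPoint k x) (gridPoint k b) ≤ 1 / k := by
  refine (dist_pi_le_iff (by positivity)).2 fun c => ?_
  have hlower : (b c : ℝ) ≤ x c := Nat.cast_le.2 (hx.1 c)
  have hupper : (x c : ℝ) ≤ b c + 1 := by exact_mod_cast hx.2 c
  calc dist (gridPoint k x c) (gridPoint k b c)
      ≤ |(x c : ℝ) / k - b c / k| := Set.abs_projIcc_sub_projIcc zero_le_one
    _ = (x c - b c) / k := by
        rw [← sub_div, abs_of_nonneg (div_nonneg (sub_nonneg.2 hlower) k.cast_nonneg)]
    _ ≤ 1 / k := by gcongr; linarith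

theorem exists_forall_dist_le_of_cover [Fintype ι] {F G : ι → Set (ι → unitInterval)}
    (hcover : ∀ c, F c ∪ G c = Set.univ) (hF : ∀ c x, x c = 0 → x ∈ F c)
    (hG : ∀ c x, x c = 1 → x ∈ G c) {k : ℕ} (hk : k ≠ 0) :
    ∃ p, ∀ c, (∃ y ∈ F c, dist y p ≤ 1 / k) ∧ ∃ y ∈ G c, dist y p ≤ 1 / k := by
  classical
  obtain ⟨b, hb⟩ := exists_unitCube_meets_of_separates_faces (fun _ => k)
    (fun c => {x : ι → ℕ | x c ≠ 0 ∧ gridPoint k x ∈ G c}) (fun c x hx h => h.1 hx)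
    (fun c x hx => ⟨hx.trans_ne hk, hG c _ (gridPoint_apply_eq_one hk hx)⟩)
  refine ⟨gridPoint k b, fun c => ?_⟩
  obtain ⟨⟨y, hy, hyG⟩, z, hz, hzG⟩ := hb c
  refine ⟨⟨gridPoint k z, ?_, dist_gridPoint_le k hz⟩, gridPoint k y, hyG.2, dist_gridPoint_le k hy⟩
  by_cases hzc : z c = 0
  · exact hF c _ (gridPoint_apply_eq_zero k hzc)
  · exact ((hcover c).ge (Set.mem_univ _)).resolve_right fun h => hzG ⟨hzc, h⟩

theorem nonempty_iInter_inter_of_isClosed_cover [Finite ι]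
    {F G : ι → Set (ι → unitInterval)} (hFc : ∀ c, IsClosed (F c))
    (hGc : ∀ c, IsClosed (G c))
    (hcover : ∀ c, F c ∪ G c = Set.univ) (hF : ∀ c x, x c = 0 → x ∈ F c)
    (hG : ∀ c x, x c = 1 → x ∈ G c) : (⋂ c, F c ∩ G c).Nonempty := by
  cases nonempty_fintype ι
  choose p hp using fun k : ℕ => exists_forall_dist_le_of_cover hcover hF hG k.succ_ne_zero
  obtain ⟨x, φ, hφ, hx⟩ := CompactSpace.tendsto_subseq p
  have hmem : ∀ H : Set (ι → unitInterval), IsClosed H →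
      (∀ k : ℕ, ∃ y ∈ H, dist y (p k) ≤ 1 / (k.succ : ℝ)) → x ∈ H := by
    intro H hH hHp
    choose y hyH hy using hHp
    have hmesh : Tendsto (fun k : ℕ => 1 / (k.succ : ℝ)) atTop (𝓝 0) := by
      simpa only [Nat.cast_succ] using tendsto_one_div_add_atTop_nhds_zero_nat (𝕜 := ℝ)
    have hdist : Tendsto (fun k => dist (p (φ k)) (y (φ k))) atTop (𝓝 0) :=
      squeeze_zero (fun _ => dist_nonneg) (fun k => (dist_comm _ _).trans_le (hy (φ k)))
        (hmesh.comp hφ.tendsto_atTop)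
    exact hH.mem_of_tendsto ((tendsto_iff_of_dist hdist).1 hx) (Eventually.of_forall fun k => hyH _)
  exact ⟨x, Set.mem_iInter.2 fun c =>
    ⟨hmem _ (hFc c) fun k => (hp k c).1, hmem _ (hGc c) fun k => (hp k c).2⟩⟩

theorem exists_isFixedPt_of_continuous [Finite ι] {f : (ι → unitInterval) → ι → unitInterval}
    (hf : Continuous f) : ∃ x, Function.IsFixedPt f x := by
  have hfc : ∀ c, Continuous fun x => f x c := continuous_pi_iff.1 hf
  obtain ⟨x, hx⟩ := nonempty_iInter_inter_of_isClosed_cover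
    (F := fun c => {x | x c ≤ f x c}) (G := fun c => {x | f x c ≤ x c})
    (fun c => isClosed_le (continuous_apply c) (hfc c))
    (fun c => isClosed_le (hfc c) (continuous_apply c))
    (fun c => Set.eq_univ_of_forall fun x => le_total (x c) (f x c))
    (fun c x hx => hx.trans_le unitInterval.nonneg')
    (fun c x hx => unitInterval.le_one'.trans_eq hx.symm)
  exact ⟨x, funext fun c => le_antisymm (Set.mem_iInter.1 hx c).2 (Set.mem_iInter.1 hx c).1⟩

end UnitCube

namespace FuzzyTruth

theorem Formula.continuous_eval {V X : Type} [TopologicalSpace X] {I : Implementation}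
    (hor : Continuous (Function.uncurry I.or')) (hand : Continuous (Function.uncurry I.and'))
    (hnot : Continuous I.not') {t : X → V → TruthValue} (ht : Continuous t) (P : Formula V) :
    Continuous fun x => P.eval I (t x) := by
  induction P with
  | elem v => exact (continuous_apply v).comp ht
  | disj P Q hP hQ => exact hor.comp (hP.prodMk hQ)
  | conj P Q hP hQ => exact hand.comp (hP.prodMk hQ)
  | neg P hP => exact hnot.comp hP

theorem continuous_agreement : Continuous (Function.uncurry agreement) :=
  Continuous.subtype_mk (by fun_prop) _

theorem continuous_truthMap {M : ℕ} {I : Implementation}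
    (hor : Continuous (Function.uncurry I.or')) (hand : Continuous (Function.uncurry I.and'))
    (hnot : Continuous I.not') (D : Fin M → SecondLevel M) : Continuous (truthMap I D) := by
  have htrElem : Continuous fun x : Fin M → TruthValue => trElem I x := continuous_pi fun C =>
    continuous_agreement.comp <|
      (Formula.continuous_eval hor hand hnot continuous_id C.sentence).prodMk continuous_const
  exact continuous_pi fun m => Formula.continuous_eval hor hand hnot htrElem (D m)

end FuzzyTruth

theorem proposition3_general (M : ℕ) (I : FuzzyTruth.Implementation)
    (hor : Continuous (Function.uncurry I.or')) (hand : Continuous (Function.uncurry I.and'))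
    (hnot : Continuous I.not') (D : Fin M → FuzzyTruth.SecondLevel M) :
    ∃ x : Fin M → FuzzyTruth.TruthValue, x = FuzzyTruth.truthMap I D x := by
  obtain ⟨x, hx⟩ := exists_isFixedPt_of_continuous
    (FuzzyTruth.continuous_truthMap hor hand hnot D)
  exact ⟨x, hx.symm⟩

theorem proposition3 (M : ℕ) (I : FuzzyTruth.Implementation) (hI : I.IsContinuousFuzzy)
    (D : Fin M → FuzzyTruth.SecondLevel M) :
    ∃ x : Fin M → FuzzyTruth.TruthValue, x = FuzzyTruth.truthMap I D x :=
  proposition3_general M I hI.continuous_or hI.continuous_and hI.continuous_not D
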